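/- Let $n,k\ge 0$ be integers and let $X$ be a symmetric $n\times n$ matrix of indeterminates. Let $P$ be a linear principal minor (lpm) polynomial on the space $\mathbb{S}^n$ of real symmetric $n\times n$ matrices, that is, $P(X)=\sum_{J\subseteq[n]}c_J\det(X_J)$ with $c_J\in\mathbb{R}$, where $X_J$ is the principal submatrix of $X$ indexed by $J$ (and $\det X_\emptyset=1$). Assume that $P$ is homogeneous of degree $k$. Call $P$ hyperbolic with respect to $I_n$ if $P(I_n)>0$ and, for every $A\in\mathbb{S}^n$, the polynomial $t\mapsto P(tI_n+A)$ has only real zeros; writing $P(tI_n+A)=P(I_n)\prod_{i=1}^k(t+\lambda_i(A))$, its hyperbolicity cone is $H(P)=\{A\in\mathbb{S}^n:\lambda_i(A)>0\text{ for all }i\}$. Call $P$ PSD-stable if $P(A+\mathrm{i}B)\neq0$ for all $A,B\in\mathbb{S}^n$ with $B$ positive definite. 1. If $P$ is PSD-stable and $P(I_n)>0$, then $P$ is hyperbolic with respect to $I_n$. 2. Suppose that $P$ is hyperbolic with respect to $I_n$ (by 1, this is so in particular if $P$ is PSD-stable and $P(I_n)>0$). Let $\Pi$ be a partition of $[n]$,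 and for $A\in\mathbb{S}^n$ let $\pi_\Pi(A)$ be the block-diagonal pinching of $A$, obtained by replacing $A_{ij}$ by $0$ whenever $i$ and $j$ lie in different blocks of $\Pi$. Then for every $A\in H(P)$, $$\pi_\Pi(A)\in H(P)\qquad\text{and}\qquad P(\pi_\Pi(A))\ge P(A).$$ -/

import Mathlib

open MvPolynomial

noncomputable section

/-- `P` is hyperbolic with respect to `a`: `P(a) > 0` and, for every real vector `x`, all complex
zeros `z` of the univariate polynomial `z ↦ P(z a + x)` are real.
(Homogeneity of `P` is assumed separately.) -/
def IsHyperbolic {σ : Type*} (P : MvPolynomial σ ℝ) (a : σ → ℝ) : Prop :=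
  0 < eval a P ∧
    ∀ (x : σ → ℝ) (z : ℂ), aeval (fun s => z * (a s : ℂ) + (x s : ℂ)) P = 0 → z.im = 0

/-- `l` is an `a`-eigenvalue of `x`: a factor `t + l` occurs in `t ↦ P(t a + x)`, that is,
`t = -l` is a zero of this univariate polynomial. -/
def IsDirEigenvalue {σ : Type*} (P : MvPolynomial σ ℝ) (a x : σ → ℝ) (l : ℝ) : Prop :=
  eval ((-l) • a + x) P = 0

/-- The (open) hyperbolicity cone of `P` in direction `a`: all `a`-eigenvalues are positive. -/
def hyperbolicityCone {σ : Type*} (P : MvPolynomial σ ℝ) (a : σ → ℝ) : Set (σ → ℝ) :=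
  {x | ∀ l : ℝ, IsDirEigenvalue P a x l → 0 < l}

/-- The generic symmetric `n × n` matrix: its `(i, j)` entry is the indeterminate `X_{ij}`
attached to the unordered pair `{i, j}`. -/
def genericSymm (n : ℕ) : Matrix (Fin n) (Fin n) (MvPolynomial (Sym2 (Fin n)) ℝ) :=
  Matrix.of fun i j => X s(i, j)

/-- The coordinates of a real symmetric matrix, indexed by unordered pairs of indices. A polynomial
on the space of real symmetric matrices is an element of `MvPolynomial (Sym2 (Fin n)) ℝ`, and
its value at `A` is its value at these coordinates. -/
def symmCoords {n : ℕ} (A : Matrix (Fin n) (Fin n) ℝ) (hA : A.IsSymm) : Sym2 (Fin n) → ℝ :=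
  Sym2.lift ⟨fun i j => A i j, fun i j => hA.apply j i⟩

/-- The coordinates of the identity matrix. -/
def idCoords (n : ℕ) : Sym2 (Fin n) → ℝ :=
  symmCoords (1 : Matrix (Fin n) (Fin n) ℝ) Matrix.isSymm_one

/-- Linear principal minor polynomials: real linear combinations of the principal minors
`det X_J`, `J ⊆ [n]`, of the generic symmetric matrix (the empty minor is `1`). -/
def IsLPM {n : ℕ} (P : MvPolynomial (Sym2 (Fin n)) ℝ) : Prop :=
  ∃ c : Finset (Fin n) → ℝ,
    P = ∑ J : Finset (Fin n), C (c J) *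
      ((genericSymm n).submatrix (fun i : J => (i : Fin n)) (fun i : J => (i : Fin n))).det

/-- PSD-stability: `P(A + iB) ≠ 0` for all real symmetric `A` and all positive definite `B`. -/
def IsPSDStable {n : ℕ} (P : MvPolynomial (Sym2 (Fin n)) ℝ) : Prop :=
  ∀ (A B : Matrix (Fin n) (Fin n) ℝ) (hA : A.IsSymm) (hB : B.IsSymm), B.PosDef →
    aeval (fun s => (symmCoords A hA s : ℂ) + Complex.I * (symmCoords B hB s : ℂ)) P ≠ 0

/-- The block-diagonal pinching of `A` along the partition `Q` of `[n]`: entries whose row and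
column indices lie in different blocks are replaced by zero. -/
def pinching {n : ℕ} (Q : Finpartition (Finset.univ : Finset (Fin n)))
    (A : Matrix (Fin n) (Fin n) ℝ) : Matrix (Fin n) (Fin n) ℝ :=
  Matrix.of fun i j => if Q.part i = Q.part j then A i j else 0

theorem pinching_isSymm {n : ℕ} (Q : Finpartition (Finset.univ : Finset (Fin n)))
    {A : Matrix (Fin n) (Fin n) ℝ} (hA : A.IsSymm) : (pinching Q A).IsSymm := by
  ext i j
  simp only [Matrix.transpose_apply, pinching, Matrix.of_apply, hA.apply i j,
    eq_comm (a := Q.part j)]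

end

/-! ### Homogeneous polynomials on complex lines: roots and their continuity. -/

section Homogeneous

variable {σ : Type*} {k : ℕ} {P : MvPolynomial σ ℝ}

/-! Let `D` be a diagonal sign matrix. Then `P(DAD) = P(A)`, because each principal minor acquires
the square of a sign; since `D I D = I`, the cone is preserved too. Taking `D` to be `-1` exactly on
one block, the average `(A + DAD)/2` kills the entries joining that block to the others, so the
pinching is a composite of such averages. Each average stays in the cone by convexity
(`add_mem_cone`). Midpoint log-concavity (`eval_mul_eval_le`) gives `P(A)² = P(A) P(DAD) ≤ P((A +
DAD)/2)²`, so `P` does not decrease. Both facts are Gårding's: for `a`, `b` in the cone, all roots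
of `t ↦ P(b + ta)` are real and negative (`neg_of_mem_cone_of_mem_cone`). That comes from two
applications of the barrier principle `aeval_ne_zero_of_homotopy`. For the implication from
stability, `B = (Im z) I` excludes roots in the upper half-plane, and homogeneity reflects this to
the lower one. -/

theorem aeval_smul_of_isHomogeneous {S : Type*} [CommRing S] [Algebra ℝ S]
    (hP : P.IsHomogeneous k) (c : S) (v : σ → S) : aeval (c • v) P = c ^ k * aeval v P := by
  simp only [aeval_def, eval₂_eq, Finset.mul_sum]
  refine Finset.sum_congr rfl fun d hd => ?_
  have hdeg : ∑ i ∈ d.support, d i = k := by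
    have h := hP (mem_support_iff.mp hd)
    simpa [Finsupp.weight_apply, Finsupp.sum] using h
  simp only [Pi.smul_apply, smul_eq_mul, mul_pow, Finset.prod_mul_distrib]
  rw [Finset.prod_pow_eq_pow_sum, hdeg]
  ring

theorem Polynomial.coeff_prod_sum_of_natDegree_le {R ι : Type*} [CommSemiring R] (s : Finset ι)
    (f : ι → Polynomial R) (m : ι → ℕ) (h : ∀ i, (f i).natDegree ≤ m i) :
    (∏ i ∈ s, f i).coeff (∑ i ∈ s, m i) = ∏ i ∈ s, (f i).coeff (m i) := by
  classical
  induction s using Finset.induction_on with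
  | empty => simp
  | insert a s ha ih =>
    rw [Finset.prod_insert ha, Finset.sum_insert ha, Finset.prod_insert ha,
      Polynomial.coeff_mul_add_eq_of_natDegree_le (h a)
        ((Polynomial.natDegree_prod_le _ _).trans (Finset.sum_le_sum fun i _ => h i)), ih]

/-- Restricted to an affine complex line, a homogeneous polynomial of degree `k` not vanishing at
the direction of the line splits into `k` linear factors. -/
theorem exists_roots_of_isHomogeneous (hP : P.IsHomogeneous k) (u v : σ → ℂ)
    (hv : aeval v P ≠ 0) :
    ∃ R : Multiset ℂ, R.card = k ∧
      ∀ z : ℂ, aeval (u + z • v) P = aeval v P * (R.map (z - ·)).prod := by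
  set l : σ → Polynomial ℂ := fun s => Polynomial.C (v s) * Polynomial.X + Polynomial.C (u s)
    with hl
  set q : Polynomial ℂ := aeval l P with hq
  have hdeg : ∀ d ∈ P.support, ∑ i ∈ d.support, d i = k := fun d hd => by
    have h := hP (mem_support_iff.mp hd)
    simpa [Finsupp.weight_apply, Finsupp.sum] using h
  have hlin : ∀ (d : σ →₀ ℕ) (i : σ), (l i ^ d i).natDegree ≤ d i := fun d i =>
    Polynomial.natDegree_pow_le_of_le (d i) Polynomial.natDegree_linear_le |>.trans (by simp)
  have hcoeff : q.coeff k = aeval v P := by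
    simp only [hq, aeval_def, eval₂_eq, Polynomial.finsetSum_coeff]
    refine Finset.sum_congr rfl fun d hd => ?_
    have : algebraMap ℝ (Polynomial ℂ) (coeff d P) = Polynomial.C (algebraMap ℝ ℂ (coeff d P)) :=
      rfl
    rw [this, Polynomial.coeff_C_mul]
    congr 1
    rw [← hdeg d hd, Polynomial.coeff_prod_sum_of_natDegree_le _ _ _ (hlin d)]
    refine Finset.prod_congr rfl fun i _ => ?_
    have := Polynomial.coeff_pow_of_natDegree_le (m := d i) (n := 1) (p := l i)
      Polynomial.natDegree_linear_le
    simpa [hl] using this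
  have hnat : q.natDegree = k := by
    refine le_antisymm ?_ (Polynomial.le_natDegree_of_ne_zero (hcoeff ▸ hv))
    simp only [hq, aeval_def, eval₂_eq]
    refine Polynomial.natDegree_sum_le_of_forall_le _ _ fun d hd => ?_
    have : algebraMap ℝ (Polynomial ℂ) (coeff d P) = Polynomial.C (algebraMap ℝ ℂ (coeff d P)) :=
      rfl
    rw [this]
    refine (Polynomial.natDegree_C_mul_le _ _).trans ?_
    rw [← hdeg d hd]
    exact (Polynomial.natDegree_prod_le _ _).trans (Finset.sum_le_sum fun i _ => hlin d i)
  have hsplit : q.Splits := IsAlgClosed.splits q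
  refine ⟨q.roots, by rw [← hsplit.natDegree_eq_card_roots, hnat], fun z => ?_⟩
  have heval : q.eval z = aeval (u + z • v) P := by
    have h := map_aeval l (Polynomial.evalRingHom z) P
    simp only [Polynomial.coe_evalRingHom] at h
    rw [hq, h, aeval_def]
    refine congrArg₂ (fun f g => eval₂ f g P) ?_ (funext fun s => ?_)
    · ext r
      simp
    · simp [hl]
      ring
  rw [← heval, hsplit.eval_eq_prod_roots, Polynomial.leadingCoeff, hnat, hcoeff]

/-- Continuity of roots in the form of a barrier principle: if the roots of `w ↦ P(u₀ + w v)` lie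
in the open lower half-plane and no root of `w ↦ P(u₀ + β u + w v)` is real for `0 ≤ β ≤ 1`,
then the roots of `w ↦ P(u₀ + u + w v)` lie in the open lower half-plane. -/
theorem aeval_ne_zero_of_homotopy (hP : P.IsHomogeneous k)
    (u₀ u v : σ → ℂ) (hv : aeval v P ≠ 0)
    (h₀ : ∀ w : ℂ, 0 ≤ w.im → aeval (u₀ + w • v) P ≠ 0)
    (hreal : ∀ β ∈ Set.Icc (0 : ℝ) 1, ∀ r : ℝ,
      aeval (u₀ + (β : ℂ) • u + (r : ℂ) • v) P ≠ 0)
    (w : ℂ) (hw : 0 ≤ w.im) : aeval (u₀ + u + w • v) P ≠ 0 := by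
  set F : ℝ → ℂ → ℂ := fun β w => aeval (u₀ + (β : ℂ) • u + w • v) P with hF
  have hcont : ∀ {X : Type} [TopologicalSpace X] (f : X → σ → ℂ), Continuous f →
      Continuous fun x => aeval (f x) P := by
    intro X _ f hf
    simp only [aeval_def, eval₂_eq]
    fun_prop
  have hFc : Continuous fun x : ℝ × ℂ => F x.1 x.2 := hcont _ (by fun_prop)
  -- This bound is a closed condition on `β` that still excludes roots in the open upper half-plane.
  -- `[0, 1]` is connected and covered by the closed sets `G` and `B`, so it is enough that they do
  -- not meet there.
  set G : Set ℝ := {β | ∀ s : ℂ, 0 < s.im → ‖aeval v P‖ * s.im ^ k ≤ ‖F β s‖} with hG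
  set B : Set ℝ := Prod.fst '' ({x : ℝ × ℂ | x.1 ∈ Set.Icc (0 : ℝ) 1 ∧ 0 ≤ x.2.im ∧
    F x.1 x.2 = 0}) with hB
  have hGcl : IsClosed G := by
    simp only [hG, Set.ofPred_forall]
    refine isClosed_iInter fun s => isClosed_iInter fun _ => isClosed_le continuous_const ?_
    exact (hFc.comp (by fun_prop : Continuous fun β : ℝ => (β, s))).norm
  have hBcl : IsClosed B := by
    -- Substituting `ζ = 1/w` turns large roots into zeros of `H` near `ζ = 0`. There `H = P(v) ≠
    -- 0`, so compactness bounds the roots uniformly in `β`.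
    set H : ℝ × ℂ → ℂ := fun x => aeval (v + x.2 • (u₀ + (x.1 : ℂ) • u)) P with hH
    have hHc : Continuous H := hcont _ (by fun_prop)
    obtain ⟨U, V, -, hV, hU, h0V, hUV⟩ := generalized_tube_lemma (s := Set.Icc (0 : ℝ) 1)
      isCompact_Icc (t := {(0 : ℂ)}) isCompact_singleton
      (n := {x | H x ≠ 0}) (isOpen_ne_fun hHc continuous_const) (by
        rintro ⟨β, ζ⟩ ⟨-, hζ⟩
        obtain rfl : ζ = 0 := hζ
        simpa [hH] using hv)
    obtain ⟨ε, hε, hball⟩ := Metric.isOpen_iff.mp hV 0 (h0V rfl)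
    have hbound : ∀ β ∈ Set.Icc (0 : ℝ) 1, ∀ w : ℂ, F β w = 0 → ‖w‖ ≤ ε⁻¹ := by
      intro β hβ w hFw
      by_contra! hlt
      have hw0 : w ≠ 0 := norm_pos_iff.mp ((inv_pos.mpr hε).trans hlt)
      have hmem : w⁻¹ ∈ V := hball (by
        rw [mem_ball_zero_iff, norm_inv]
        exact inv_lt_of_inv_lt₀ hε hlt)
      refine hUV (Set.mk_mem_prod (hU hβ) hmem) ?_
      have h := aeval_smul_of_isHomogeneous hP w (v + w⁻¹ • (u₀ + (β : ℂ) • u))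
      rw [smul_add, smul_inv_smul₀ hw0, add_comm, show aeval _ P = (0 : ℂ) from hFw] at h
      exact (mul_eq_zero.mp h.symm).resolve_left (pow_ne_zero _ hw0)
    have hcomp : IsCompact {x : ℝ × ℂ | x.1 ∈ Set.Icc (0 : ℝ) 1 ∧ 0 ≤ x.2.im ∧
        F x.1 x.2 = 0} := by
      refine ((isCompact_Icc (a := (0 : ℝ)) (b := 1)).prod (isCompact_closedBall (0 : ℂ) ε⁻¹)).of_isClosed_subset ?_ ?_
      · refine (isClosed_Icc.preimage continuous_fst).inter (IsClosed.inter ?_ ?_)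
        · exact isClosed_le continuous_const (Complex.continuous_im.comp continuous_snd)
        · exact isClosed_eq hFc continuous_const
      · rintro ⟨β, w⟩ ⟨hβ, -, hFw⟩
        exact ⟨hβ, by simpa using hbound β hβ w hFw⟩
    exact (hcomp.image continuous_fst).isClosed
  have hmemG : ∀ β, (∀ w : ℂ, 0 ≤ w.im → F β w ≠ 0) → β ∈ G := by
    intro β hβ s hs
    obtain ⟨R, hR, hfac⟩ := exists_roots_of_isHomogeneous hP (u₀ + (β : ℂ) • u) v hv
    have hroot : ∀ r ∈ R, r.im < 0 := fun r hr => by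
      by_contra! hr0
      refine hβ r hr0 ?_
      simp only [hF]
      rw [hfac r, Multiset.prod_eq_zero (Multiset.mem_map.mpr ⟨r, hr, sub_self r⟩), mul_zero]
    simp only [hF]
    rw [hfac s, norm_mul]
    refine mul_le_mul_of_nonneg_left ?_ (norm_nonneg _)
    rw [← hR]
    clear hR hfac
    induction R using Multiset.induction_on with
    | empty => simp
    | cons a R ih =>
      rw [Multiset.map_cons, Multiset.prod_cons, norm_mul, Multiset.card_cons, pow_succ']
      refine mul_le_mul ?_ (ih fun r hr => hroot r (Multiset.mem_cons_of_mem hr))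
        (pow_nonneg hs.le _) (norm_nonneg _)
      -- A root `a` below the real axis satisfies `|s - a| ≥ Im s`.
      have h1 := hroot a (Multiset.mem_cons_self a R)
      have h2 := (le_abs_self _).trans (Complex.abs_im_le_norm (s - a))
      rw [Complex.sub_im] at h2
      linarith
  have hdisj : Set.Icc (0 : ℝ) 1 ∩ (G ∩ B) = ∅ := by
    rw [Set.eq_empty_iff_forall_notMem]
    rintro β ⟨hβ, hβG, ⟨β', w⟩, ⟨-, hw, hFw⟩, rfl⟩
    rcases hw.eq_or_lt with h | h
    · refine hreal _ hβ w.re ?_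
      have : ((w.re : ℝ) : ℂ) = w := Complex.ext rfl (by simpa using h)
      rw [this]
      exact hFw
    · have := hβG w h
      simp only at this hFw
      rw [hFw, norm_zero] at this
      exact absurd this (not_le.mpr (mul_pos (norm_pos_iff.mpr hv) (pow_pos h k)))
  intro hzero
  have hne := isPreconnected_closed_iff.mp (isPreconnected_Icc (a := (0 : ℝ)) (b := 1)) G B
    hGcl hBcl
    (fun β hβ => by
      by_cases h : ∀ w : ℂ, 0 ≤ w.im → F β w ≠ 0
      · exact Or.inl (hmemG β h)
      · push Not at h
        obtain ⟨w, hw, hFw⟩ := h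
        exact Or.inr ⟨(β, w), ⟨hβ, hw, hFw⟩, rfl⟩)
    ⟨0, by simp, hmemG 0 fun w hw => by simpa [hF] using h₀ w hw⟩
    ⟨1, by simp, (1, w), ⟨by simp, hw, by simpa [hF] using hzero⟩, rfl⟩
  rw [hdisj] at hne
  exact Set.not_nonempty_empty hne

end Homogeneous

/-! ### Gårding's theory of the hyperbolicity cone. -/

section Hyperbolic

variable {σ : Type*} {k : ℕ} {P : MvPolynomial σ ℝ}

/-- The complexification of a real vector. -/
def complexify (x : σ → ℝ) : σ → ℂ := fun s => (x s : ℂ)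

theorem complexify_add (x y : σ → ℝ) : complexify (x + y) = complexify x + complexify y := by
  ext s; simp [complexify]

theorem complexify_smul (c : ℝ) (x : σ → ℝ) : complexify (c • x) = (c : ℂ) • complexify x := by
  ext s; simp [complexify]

theorem aeval_complexify (x : σ → ℝ) : aeval (complexify x) P = (eval x P : ℂ) := by
  have h := aeval_algebraMap_apply ℂ x P
  rwa [aeval_eq_eval] at h

theorem eval_smul_of_isHomogeneous (hP : P.IsHomogeneous k) (c : ℝ) (x : σ → ℝ) :
    eval (c • x) P = c ^ k * eval x P := by
  simpa only [aeval_eq_eval] using aeval_smul_of_isHomogeneous hP c x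

namespace IsHyperbolic

variable {e a b : σ → ℝ}

theorem im_eq_zero (he : IsHyperbolic P e) (x : σ → ℝ) {z : ℂ}
    (hz : aeval (complexify x + z • complexify e) P = 0) : z.im = 0 := by
  refine he.2 x z ?_
  rw [← hz, add_comm]
  rfl

theorem neg_of_mem_cone (he : IsHyperbolic P e) (ha : a ∈ hyperbolicityCone P e) {z : ℂ}
    (hz : aeval (complexify a + z • complexify e) P = 0) : ∃ t : ℝ, t < 0 ∧ z = t := by
  have hzr : z = (z.re : ℂ) := Complex.ext rfl (by simpa using he.im_eq_zero a hz)
  refine ⟨z.re, ?_, hzr⟩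
  rw [hzr, ← complexify_smul, ← complexify_add, aeval_complexify] at hz
  have := ha (-z.re) (by
    rw [IsDirEigenvalue, neg_neg, add_comm]
    exact_mod_cast hz)
  linarith

theorem eval_ne_zero_of_mem_cone (he : IsHyperbolic P e) (ha : a ∈ hyperbolicityCone P e) :
    eval a P ≠ 0 := by
  intro h
  obtain ⟨t, ht, ht'⟩ := he.neg_of_mem_cone ha (z := 0) (by simp [aeval_complexify, h])
  have : t = 0 := by exact_mod_cast ht'.symm
  exact ht.ne this

theorem aeval_ne_zero_of_mem_cone (he : IsHyperbolic P e) (ha : a ∈ hyperbolicityCone P e) :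
    aeval (complexify a) P ≠ (0 : ℂ) := by
  rw [aeval_complexify]
  exact_mod_cast he.eval_ne_zero_of_mem_cone ha

/-- The homotopy switches on `x`. At its start a zero forces `αi = wt` with `t < 0`, hence `Im w <
0`; a real `w` at any stage would give `P` the nonreal root `αi` on a line in direction `e`. -/
theorem aeval_add_smul_ne_zero (hP : P.IsHomogeneous k) (he : IsHyperbolic P e)
    (ha : a ∈ hyperbolicityCone P e) {α : ℝ} (hα : 0 < α) (x : σ → ℝ) {w : ℂ} (hw : 0 ≤ w.im) :
    aeval ((α * Complex.I) • complexify e + complexify x + w • complexify a) P ≠ 0 := by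
  refine aeval_ne_zero_of_homotopy hP _ _ _ (he.aeval_ne_zero_of_mem_cone ha) ?_ ?_ w hw
  · intro w hw h0
    rcases eq_or_ne w 0 with rfl | hw0
    · rw [zero_smul, add_zero, aeval_smul_of_isHomogeneous hP, aeval_complexify] at h0
      have h1 : ((α : ℂ) * Complex.I) ^ k ≠ 0 :=
        pow_ne_zero _ (mul_ne_zero (by exact_mod_cast hα.ne') Complex.I_ne_zero)
      exact mul_ne_zero h1 (by exact_mod_cast he.1.ne') h0
    · have h1 := aeval_smul_of_isHomogeneous hP w
        (complexify a + (w⁻¹ * (α * Complex.I)) • complexify e)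
      rw [smul_add, smul_smul, mul_inv_cancel_left₀ hw0, add_comm, h0] at h1
      obtain ⟨t, ht, hwt⟩ := he.neg_of_mem_cone ha
        ((mul_eq_zero.mp h1.symm).resolve_left (pow_ne_zero _ hw0))
      rw [inv_mul_eq_iff_eq_mul₀ hw0] at hwt
      have h2 := congrArg Complex.im hwt
      simp at h2
      nlinarith
  · intro β _ r h0
    have h1 := he.im_eq_zero (β • x + r • a) (z := α * Complex.I) (by
      rw [← h0, complexify_add, complexify_smul, complexify_smul]
      congr 1
      abel_nf)
    simp at h1
    exact hα.ne' h1

/-- A second homotopy switches on `x + za`. For real `w` the term `wb` joins the real vector, so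
`aeval_add_smul_ne_zero` for `a` is the barrier. -/
theorem aeval_add_smul_add_smul_ne_zero (hP : P.IsHomogeneous k) (he : IsHyperbolic P e)
    (ha : a ∈ hyperbolicityCone P e) (hb : b ∈ hyperbolicityCone P e) {α : ℝ} (hα : 0 < α)
    (x : σ → ℝ) {z w : ℂ} (hz : 0 ≤ z.im) (hw : 0 ≤ w.im) :
    aeval ((α * Complex.I) • complexify e + (complexify x + z • complexify a)
      + w • complexify b) P ≠ 0 := by
  refine aeval_ne_zero_of_homotopy hP _ _ _ (he.aeval_ne_zero_of_mem_cone hb) ?_ ?_ w hw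
  · intro w hw
    have h := he.aeval_add_smul_ne_zero hP hb hα 0 hw
    have h0 : complexify (0 : σ → ℝ) = 0 := by ext; simp [complexify]
    rwa [h0, add_zero] at h
  · intro β hβ r
    have h := he.aeval_add_smul_ne_zero hP ha hα (β • x + r • b) (w := β * z)
      (by simpa using mul_nonneg hβ.1 hz)
    have heq : (α * Complex.I) • complexify e + (β : ℂ) • (complexify x + z • complexify a)
        + (r : ℂ) • complexify b = (α * Complex.I) • complexify e + complexify (β • x + r • b)
        + ((β : ℂ) * z) • complexify a := by
      rw [complexify_add, complexify_smul, complexify_smul]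
      module
    rwa [heq]

/-- The hyperbolicity cone is open in the direction of hyperbolicity. -/
theorem exists_sub_smul_mem_cone (hP : P.IsHomogeneous k) (he : IsHyperbolic P e)
    (ha : a ∈ hyperbolicityCone P e) : ∃ δ : ℝ, 0 < δ ∧ a - δ • e ∈ hyperbolicityCone P e := by
  obtain ⟨R, -, hR⟩ := exists_roots_of_isHomogeneous hP (complexify a) (complexify e) (by
    rw [aeval_complexify]
    exact_mod_cast he.1.ne')
  have hneg : ∀ r ∈ R, r.re < 0 := fun r hr => by
    obtain ⟨t, ht, rfl⟩ := he.neg_of_mem_cone ha (z := r) (by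
      rw [hR r, Multiset.prod_eq_zero (Multiset.mem_map.mpr ⟨r, hr, sub_self r⟩), mul_zero])
    simpa using ht
  obtain ⟨δ, hδ, hδR⟩ : ∃ δ : ℝ, 0 < δ ∧ ∀ r ∈ R, r.re < -δ := by
    clear hR
    induction R using Multiset.induction_on with
    | empty => exact ⟨1, one_pos, by simp⟩
    | cons c R ih =>
      obtain ⟨δ, hδ, h⟩ := ih fun r hr => hneg r (Multiset.mem_cons_of_mem hr)
      have hc := hneg c (Multiset.mem_cons_self c R)
      refine ⟨min δ (-c.re / 2), lt_min hδ (by linarith), fun r hr => ?_⟩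
      rcases Multiset.mem_cons.mp hr with rfl | hr
      · have := min_le_right δ (-r.re / 2)
        linarith
      · have := min_le_left δ (-c.re / 2)
        linarith [h r hr]
  refine ⟨δ, hδ, fun l hl => ?_⟩
  have h1 : aeval (complexify a + ((-(l + δ) : ℝ) : ℂ) • complexify e) P = 0 := by
    rw [← complexify_smul, ← complexify_add, aeval_complexify]
    have : a + (-(l + δ)) • e = (-l) • e + (a - δ • e) := by module
    rw [this, show eval _ P = 0 from hl, Complex.ofReal_zero]
  rw [hR] at h1
  have h2 := (mul_eq_zero.mp h1).resolve_left (by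
    rw [aeval_complexify]
    exact_mod_cast he.1.ne')
  obtain ⟨r, hr, hr0⟩ := Multiset.mem_map.mp (Multiset.prod_eq_zero_iff.mp h2)
  have h3 := hδR r hr
  rw [← sub_eq_zero.mp hr0, Complex.ofReal_re] at h3
  linarith

/-- The auxiliary term `αi e` is absorbed by writing `za = z(a - δe) + zδe`: the imaginary part of
`zδ` serves as `α`, and its real part goes into the free real vector. -/
theorem aeval_smul_add_smul_ne_zero (hP : P.IsHomogeneous k) (he : IsHyperbolic P e)
    (ha : a ∈ hyperbolicityCone P e) (hb : b ∈ hyperbolicityCone P e) {z w : ℂ}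
    (hz : 0 < z.im) (hw : 0 ≤ w.im) : aeval (z • complexify a + w • complexify b) P ≠ 0 := by
  obtain ⟨δ, hδ, ha'⟩ := he.exists_sub_smul_mem_cone hP ha
  have h := he.aeval_add_smul_add_smul_ne_zero hP ha' hb (mul_pos hz hδ) ((z.re * δ) • e)
    hz.le hw
  have heq : (((z.im * δ : ℝ) : ℂ) * Complex.I) • complexify e + (complexify ((z.re * δ) • e)
      + z • complexify (a - δ • e)) + w • complexify b
      = z • complexify a + w • complexify b := by
    have hz' : z = z.re + z.im * Complex.I := (Complex.re_add_im z).symm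
    ext s
    simp only [complexify, Pi.add_apply, Pi.smul_apply, Pi.sub_apply, smul_eq_mul]
    push_cast
    linear_combination (-(δ : ℂ) * e s) * hz'
  rwa [heq] at h

/-- The roots of `z ↦ P(b + z a)` are real and negative when `a` and `b` lie in the hyperbolicity
cone. -/
theorem neg_of_mem_cone_of_mem_cone (hP : P.IsHomogeneous k) (he : IsHyperbolic P e)
    (ha : a ∈ hyperbolicityCone P e) (hb : b ∈ hyperbolicityCone P e) {z : ℂ}
    (hz : aeval (complexify b + z • complexify a) P = 0) : ∃ t : ℝ, t < 0 ∧ z = t := by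
  have key : ∀ w : ℂ, 0 ≤ w.im → ¬ 0 < (w * z).im := fun w hw hwz => by
    refine he.aeval_smul_add_smul_ne_zero hP ha hb hwz hw ?_
    have heq : (w * z) • complexify a + w • complexify b
        = w • (complexify b + z • complexify a) := by module
    rw [heq, aeval_smul_of_isHomogeneous hP, hz, mul_zero]
  have him : z.im = 0 := by
    by_contra h
    -- This `w` is chosen so that `Im (wz) = 1`.
    refine key ⟨(1 - z.re) / z.im, 1⟩ zero_le_one ?_
    rw [Complex.mul_im]
    simp [div_mul_cancel₀ _ h]
  have hzr : z = (z.re : ℂ) := Complex.ext rfl (by simpa using him)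
  refine ⟨z.re, ?_, hzr⟩
  have hle : z.re ≤ 0 := by simpa using key Complex.I (by simp)
  refine lt_of_le_of_ne hle fun h0 => he.aeval_ne_zero_of_mem_cone hb ?_
  rw [h0, Complex.ofReal_zero] at hzr
  simpa [hzr] using hz

theorem exists_pos_factorization (hP : P.IsHomogeneous k) (he : IsHyperbolic P e)
    (ha : a ∈ hyperbolicityCone P e) (hb : b ∈ hyperbolicityCone P e) :
    ∃ R : Multiset ℝ, R.card = k ∧ (∀ r ∈ R, 0 < r) ∧
      ∀ t : ℝ, eval (b + t • a) P = eval a P * (R.map (t + ·)).prod := by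
  obtain ⟨R, hcard, hR⟩ := exists_roots_of_isHomogeneous hP (complexify b) (complexify a)
    (he.aeval_ne_zero_of_mem_cone ha)
  have hneg : ∀ r ∈ R, r.re < 0 ∧ r = r.re := fun r hr => by
    obtain ⟨t, ht, rfl⟩ := he.neg_of_mem_cone_of_mem_cone hP ha hb (z := r) (by
      rw [hR r, Multiset.prod_eq_zero (Multiset.mem_map.mpr ⟨r, hr, sub_self r⟩), mul_zero])
    simpa using ht
  refine ⟨R.map fun r => -r.re, by simpa using hcard, ?_, fun t => ?_⟩
  · intro r hr
    obtain ⟨c, hc, rfl⟩ := Multiset.mem_map.mp hr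
    linarith [(hneg c hc).1]
  · have h := hR t
    rw [← complexify_smul, ← complexify_add, aeval_complexify, aeval_complexify] at h
    apply Complex.ofReal_injective
    rw [h, Complex.ofReal_mul, ← Complex.ofRealHom_eq_coe (Multiset.prod _), map_multiset_prod,
      Multiset.map_map, Multiset.map_map]
    congr 2
    refine Multiset.map_congr rfl fun r hr => ?_
    conv_lhs => rw [(hneg r hr).2]
    simp [sub_eq_add_neg]

theorem mem_cone_self (hP : P.IsHomogeneous k) (he : IsHyperbolic P e) :
    e ∈ hyperbolicityCone P e := by
  intro l hl
  have heq : (-l) • e + e = (1 - l) • e := by module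
  have h := eval_smul_of_isHomogeneous hP (1 - l) e
  rw [IsDirEigenvalue, heq, h] at hl
  have h1 := eq_zero_of_pow_eq_zero ((mul_eq_zero.mp hl).resolve_right he.1.ne')
  linarith

theorem eval_pos_of_mem_cone (hP : P.IsHomogeneous k) (he : IsHyperbolic P e)
    (ha : a ∈ hyperbolicityCone P e) : 0 < eval a P := by
  obtain ⟨R, -, hpos, hR⟩ := he.exists_pos_factorization hP (he.mem_cone_self hP) ha
  have h := hR 0
  rw [zero_smul, add_zero] at h
  rw [h]
  exact mul_pos he.1 (Multiset.prod_pos (by simpa using hpos))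

theorem add_mem_cone (hP : P.IsHomogeneous k) (he : IsHyperbolic P e)
    (ha : a ∈ hyperbolicityCone P e) (hb : b ∈ hyperbolicityCone P e) :
    a + b ∈ hyperbolicityCone P e := by
  intro l hl
  by_contra! hl0
  -- Adding `-l e` with `l ≤ 0` only raises the eigenvalues of `a`. Then `P` is positive at `b + (a
  -- - l e)`, so `l` is no eigenvalue of `a + b`.
  have hc : (-l) • e + a ∈ hyperbolicityCone P e := fun m hm => by
    have := ha (m + l) (by
      rw [IsDirEigenvalue] at hm ⊢
      rw [← hm]
      congr 2
      module)
    linarith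
  obtain ⟨R, -, hpos, hR⟩ := he.exists_pos_factorization hP hc hb
  have h := hR 1
  have heq : b + (1 : ℝ) • ((-l) • e + a) = (-l) • e + (a + b) := by module
  rw [heq, show eval _ P = 0 from hl] at h
  refine (mul_pos (he.eval_pos_of_mem_cone hP hc) (Multiset.prod_pos ?_)).ne h
  intro r hr
  obtain ⟨c, hc, rfl⟩ := Multiset.mem_map.mp hr
  linarith [hpos c hc]

theorem smul_mem_cone (hP : P.IsHomogeneous k) {c : ℝ} (hc : 0 < c)
    (ha : a ∈ hyperbolicityCone P e) : c • a ∈ hyperbolicityCone P e := by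
  intro l hl
  have heq : (-l) • e + c • a = c • ((-(c⁻¹ * l)) • e + a) := by
    rw [smul_add, smul_smul, mul_neg, mul_inv_cancel_left₀ hc.ne']
  have h := eval_smul_of_isHomogeneous hP c ((-(c⁻¹ * l)) • e + a)
  rw [IsDirEigenvalue, heq, h] at hl
  have h1 := ha _ ((mul_eq_zero.mp hl).resolve_left (pow_ne_zero _ hc.ne'))
  exact (mul_pos_iff_of_pos_left (inv_pos.mpr hc)).mp h1

/-- Log-concavity of a hyperbolic polynomial on its hyperbolicity cone, at the midpoint. -/
theorem eval_mul_eval_le (hP : P.IsHomogeneous k) (he : IsHyperbolic P e)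
    (ha : a ∈ hyperbolicityCone P e) (hb : b ∈ hyperbolicityCone P e) :
    eval a P * eval b P ≤ eval ((1 / 2 : ℝ) • (a + b)) P ^ 2 := by
  obtain ⟨R, hcard, hpos, hR⟩ := he.exists_pos_factorization hP ha hb
  have h0 := hR 0
  have h1 := hR 1
  have hs := eval_smul_of_isHomogeneous hP (1 / 2 : ℝ) (a + b)
  simp only [zero_smul, add_zero, zero_add, Multiset.map_id'] at h0
  rw [one_smul, add_comm] at h1
  have hprod : R.prod ≤ ((1 / 2) ^ k * (R.map (1 + ·)).prod) ^ 2 := by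
    rw [← hcard]
    clear hcard hR h0 h1
    induction R using Multiset.induction_on with
    | empty => simp
    | cons c R ih =>
      have hc := hpos c (Multiset.mem_cons_self c R)
      have hR := fun r hr => hpos r (Multiset.mem_cons_of_mem hr)
      -- AM-GM for `1` and `c`, applied factor by factor.
      have h2 : c ≤ (1 / 2 * (1 + c)) ^ 2 := by nlinarith [sq_nonneg (1 - c)]
      have h3 := mul_le_mul h2 (ih hR) (Multiset.prod_pos hR).le (sq_nonneg _)
      rw [Multiset.prod_cons, Multiset.map_cons, Multiset.prod_cons, Multiset.card_cons, pow_succ]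
      refine h3.trans_eq ?_
      ring
  rw [hs, h1, h0]
  calc eval a P * (eval a P * R.prod) = eval a P ^ 2 * R.prod := by ring
    _ ≤ eval a P ^ 2 * ((1 / 2) ^ k * (R.map (1 + ·)).prod) ^ 2 :=
      mul_le_mul_of_nonneg_left hprod (sq_nonneg _)
    _ = _ := by ring

end IsHyperbolic

end Hyperbolic

/-! ### Sign changes, pinchings and PSD-stability. -/

section LPM

variable {n k : ℕ} {P : MvPolynomial (Sym2 (Fin n)) ℝ}

/-- The diagonal sign change `A ↦ D A D`, `D = diag d`, in coordinates. -/
def signChange (d : Fin n → ℝ) (x : Sym2 (Fin n) → ℝ) : Sym2 (Fin n) → ℝ :=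
  fun s => Sym2.lift ⟨fun i j => d i * d j, fun i j => mul_comm (d i) (d j)⟩ s * x s

theorem signChange_add (d : Fin n → ℝ) (x y : Sym2 (Fin n) → ℝ) :
    signChange d (x + y) = signChange d x + signChange d y := by
  ext s; simp [signChange, mul_add]

theorem signChange_smul (d : Fin n → ℝ) (c : ℝ) (x : Sym2 (Fin n) → ℝ) :
    signChange d (c • x) = c • signChange d x := by
  ext s; simp only [signChange, Pi.smul_apply, smul_eq_mul]; ring

theorem signChange_idCoords {d : Fin n → ℝ} (hd : ∀ i, d i * d i = 1) :
    signChange d (idCoords n) = idCoords n := by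
  ext s
  induction s using Sym2.ind with
  | _ i j =>
    by_cases h : i = j
    · subst h
      simp [signChange, hd]
    · simp [signChange, idCoords, symmCoords, Matrix.one_apply_ne h]

theorem IsLPM.eval_signChange (hP : IsLPM P) {d : Fin n → ℝ} (hd : ∀ i, d i * d i = 1)
    (x : Sym2 (Fin n) → ℝ) : eval (signChange d x) P = eval x P := by
  obtain ⟨c, rfl⟩ := hP
  simp only [map_sum, map_mul, eval_C, RingHom.map_det]
  refine Finset.sum_congr rfl fun J _ => ?_
  congr 1
  set M : Matrix J J ℝ := Matrix.of fun i j => x s(i, j) with hM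
  have h1 : (eval x).mapMatrix ((genericSymm n).submatrix (fun i : J => (i : Fin n))
      (fun i : J => (i : Fin n))) = M := by
    ext i j
    simp [genericSymm, hM]
  have h2 : (eval (signChange d x)).mapMatrix ((genericSymm n).submatrix
      (fun i : J => (i : Fin n)) (fun i : J => (i : Fin n)))
      = Matrix.diagonal (fun i : J => d i) * M * Matrix.diagonal (fun i : J => d i) := by
    ext i j
    rw [Matrix.mul_diagonal, Matrix.diagonal_mul]
    simp only [genericSymm, hM, signChange, RingHom.mapMatrix_apply, Matrix.map_apply,
      Matrix.submatrix_apply, Matrix.of_apply, eval_X, Sym2.lift_mk]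
    ring
  rw [h1, h2, Matrix.det_mul, Matrix.det_mul, Matrix.det_diagonal]
  have h3 : (∏ i : J, d i) * ∏ i : J, d i = 1 := by
    rw [← Finset.prod_mul_distrib]
    exact Finset.prod_eq_one fun i _ => hd i
  linear_combination M.det * h3

theorem IsLPM.signChange_mem_cone (hP : IsLPM P) {d : Fin n → ℝ} (hd : ∀ i, d i * d i = 1)
    {x : Sym2 (Fin n) → ℝ} (hx : x ∈ hyperbolicityCone P (idCoords n)) :
    signChange d x ∈ hyperbolicityCone P (idCoords n) := by
  intro l hl
  refine hx l ?_
  rw [IsDirEigenvalue, ← hP.eval_signChange hd, signChange_add, signChange_smul,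
    signChange_idCoords hd]
  exact hl

/-- The hyperbolic Fischer inequality for averaging over one diagonal sign change. -/
theorem IsLPM.average_signChange (hlpm : IsLPM P) (hP : P.IsHomogeneous k)
    (he : IsHyperbolic P (idCoords n)) {d : Fin n → ℝ} (hd : ∀ i, d i * d i = 1)
    {x : Sym2 (Fin n) → ℝ} (hx : x ∈ hyperbolicityCone P (idCoords n)) :
    (1 / 2 : ℝ) • (x + signChange d x) ∈ hyperbolicityCone P (idCoords n) ∧
      eval x P ≤ eval ((1 / 2 : ℝ) • (x + signChange d x)) P := by
  have hx' := hlpm.signChange_mem_cone hd hx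
  have hmem := IsHyperbolic.smul_mem_cone hP one_half_pos (he.add_mem_cone hP hx hx')
  refine ⟨hmem, ?_⟩
  have h := he.eval_mul_eval_le hP hx hx'
  rw [hlpm.eval_signChange hd, ← sq] at h
  exact le_of_sq_le_sq h (he.eval_pos_of_mem_cone hP hmem).le

/-- Pinching separating the blocks of the elements of `S` from all other blocks. -/
def partialPinching (Q : Finpartition (Finset.univ : Finset (Fin n))) (S : Finset (Fin n))
    (x : Sym2 (Fin n) → ℝ) : Sym2 (Fin n) → ℝ := fun s =>
  Sym2.lift ⟨fun i j => if ∀ m ∈ S, (Q.part i = Q.part m ↔ Q.part j = Q.part m) then (1 : ℝ)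
    else 0, fun i j => by simp only [iff_comm]⟩ s * x s

/-- The sign change negates exactly the entries with one index in the block of `a`; averaging
removes these and fixes the rest. -/
theorem partialPinching_insert (Q : Finpartition (Finset.univ : Finset (Fin n)))
    (S : Finset (Fin n)) (a : Fin n) (x : Sym2 (Fin n) → ℝ) :
    partialPinching Q (insert a S) x = (1 / 2 : ℝ) • (partialPinching Q S x +
      signChange (fun i => if Q.part i = Q.part a then -1 else 1) (partialPinching Q S x)) := by
  ext s
  induction s using Sym2.ind with
  | _ i j =>
    simp only [partialPinching, signChange, Sym2.lift_mk, Finset.forall_mem_insert, Pi.smul_apply,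
      Pi.add_apply, smul_eq_mul]
    by_cases hi : Q.part i = Q.part a <;> by_cases hj : Q.part j = Q.part a <;>
      simp [hi, hj] <;> (try split_ifs) <;> ring

theorem partialPinching_univ (Q : Finpartition (Finset.univ : Finset (Fin n)))
    (A : Matrix (Fin n) (Fin n) ℝ) (hA : A.IsSymm) :
    partialPinching Q Finset.univ (symmCoords A hA)
      = symmCoords (pinching Q A) (pinching_isSymm Q hA) := by
  ext s
  induction s using Sym2.ind with
  | _ i j =>
    have h : (∀ m ∈ Finset.univ, (Q.part i = Q.part m ↔ Q.part j = Q.part m)) ↔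
        Q.part i = Q.part j :=
      -- Testing with `m = i` suffices.
      ⟨fun h => ((h i (Finset.mem_univ i)).mp rfl).symm, fun h m _ => by rw [h]⟩
    simp only [partialPinching, symmCoords, pinching, Sym2.lift_mk, Matrix.of_apply, h]
    split_ifs <;> simp

theorem IsLPM.eval_le_eval_partialPinching (hlpm : IsLPM P) (hP : P.IsHomogeneous k)
    (he : IsHyperbolic P (idCoords n)) (Q : Finpartition (Finset.univ : Finset (Fin n)))
    (S : Finset (Fin n)) {x : Sym2 (Fin n) → ℝ} (hx : x ∈ hyperbolicityCone P (idCoords n)) :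
    partialPinching Q S x ∈ hyperbolicityCone P (idCoords n) ∧
      eval x P ≤ eval (partialPinching Q S x) P := by
  induction S using Finset.induction_on with
  | empty =>
    have h : partialPinching Q ∅ x = x := by
      ext s
      induction s using Sym2.ind with
      | _ i j => simp [partialPinching]
    rw [h]
    exact ⟨hx, le_rfl⟩
  | insert a S _ ih =>
    have h := hlpm.average_signChange hP he
      (d := fun i => if Q.part i = Q.part a then -1 else 1)
      (fun i => by split_ifs <;> norm_num) ih.1
    rw [partialPinching_insert]
    exact ⟨h.1, ih.2.trans h.2⟩

theorem exists_symmCoords_eq (x : Sym2 (Fin n) → ℝ) :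
    ∃ (A : Matrix (Fin n) (Fin n) ℝ) (hA : A.IsSymm), symmCoords A hA = x := by
  refine ⟨Matrix.of fun i j => x s(i, j), ?_, ?_⟩
  · ext i j
    simp [Sym2.eq_swap]
  · ext s
    induction s using Sym2.ind with
    | _ i j => simp [symmCoords]

theorem IsPSDStable.aeval_ne_zero (hst : IsPSDStable P) (x : Sym2 (Fin n) → ℝ) {z : ℂ}
    (hz : 0 < z.im) : aeval (complexify x + z • complexify (idCoords n)) P ≠ 0 := by
  obtain ⟨A, hA, hAx⟩ := exists_symmCoords_eq (x + z.re • idCoords n)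
  have hB : (z.im • (1 : Matrix (Fin n) (Fin n) ℝ)).IsSymm := by
    simp [Matrix.IsSymm]
  have h := hst A (z.im • 1) hA hB (Matrix.PosDef.one.smul hz)
  have hcB : ∀ s, symmCoords (z.im • (1 : Matrix (Fin n) (Fin n) ℝ)) hB s
      = z.im * idCoords n s := by
    intro s
    induction s using Sym2.ind with
    | _ i j => simp [symmCoords, idCoords]
  have heq : (fun s => (symmCoords A hA s : ℂ) +
      Complex.I * (symmCoords (z.im • (1 : Matrix (Fin n) (Fin n) ℝ)) hB s : ℂ))
      = complexify x + z • complexify (idCoords n) := by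
    ext s
    rw [hcB, hAx]
    simp only [complexify, Pi.add_apply, Pi.smul_apply, smul_eq_mul]
    push_cast
    linear_combination (idCoords n s : ℂ) * (Complex.re_add_im z)
  rwa [heq] at h

theorem IsPSDStable.isHyperbolic (hP : P.IsHomogeneous k) (hst : IsPSDStable P)
    (hpos : 0 < eval (idCoords n) P) : IsHyperbolic P (idCoords n) := by
  refine ⟨hpos, fun x z hz => ?_⟩
  have hz' : aeval (complexify x + z • complexify (idCoords n)) P = 0 := by
    rw [← hz, add_comm]
    rfl
  rcases lt_trichotomy z.im 0 with h | h | h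
  -- Negating the whole argument moves `z` to the upper half-plane and changes `P` only by `(-1)^k`.
  · refine absurd ?_ (hst.aeval_ne_zero (-x) (z := -z) (by simpa using h))
    have heq : complexify (-x) + (-z) • complexify (idCoords n)
        = (-1 : ℂ) • (complexify x + z • complexify (idCoords n)) := by
      ext s
      simp [complexify]
      ring
    rw [heq, aeval_smul_of_isHomogeneous hP, hz', mul_zero]
  · exact h
  · exact absurd hz' (hst.aeval_ne_zero x h)

end LPM

theorem theorem3p13 (n k : ℕ) (P : MvPolynomial (Sym2 (Fin n)) ℝ)
    (hlpm : IsLPM P) (hhom : P.IsHomogeneous k) :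
    (IsPSDStable P → 0 < MvPolynomial.eval (idCoords n) P → IsHyperbolic P (idCoords n)) ∧
    (IsHyperbolic P (idCoords n) →
      ∀ (Q : Finpartition (Finset.univ : Finset (Fin n)))
        (A : Matrix (Fin n) (Fin n) ℝ) (hA : A.IsSymm),
        symmCoords A hA ∈ hyperbolicityCone P (idCoords n) →
          symmCoords (pinching Q A) (pinching_isSymm Q hA) ∈ hyperbolicityCone P (idCoords n) ∧
          MvPolynomial.eval (symmCoords A hA) P ≤
            MvPolynomial.eval (symmCoords (pinching Q A) (pinching_isSymm Q hA)) P) := by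
  refine ⟨fun hst hpos => hst.isHyperbolic hhom hpos, fun he Q A hA hmem => ?_⟩
  rw [← partialPinching_univ]
  exact hlpm.eval_le_eval_partialPinching hhom he Q Finset.univ hmem
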